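/- For $n\ge 2$ let $\Gamma_n$ be the set of all $(\alpha,\beta)$ with $\alpha,\beta>0$ and $\frac n2\frac{\pi}{\sqrt\alpha}+\frac n2\frac{\pi}{\sqrt\beta}=\pi$ if $n$ is even, respectively $\frac{n+1}2\frac{\pi}{\sqrt\alpha}+\frac{n-1}2\frac{\pi}{\sqrt\beta}=\pi$ if $n$ is odd. For $n\ge2$ and $(\alpha,\beta)\in\Gamma_n$ let $f^n_{\alpha,\beta}$ be the normalized Fučík eigenfunction, that is, the solution $u\in C^2[0,\pi]$ of $$-u''=\alpha u^+-\beta u^-\ \text{ in }(0,\pi),\qquad u(0)=u(\pi)=0,$$ with $u'(0)>0$ and $\sup_{[0,\pi]}|u|=1$, where $u^{\pm}=\max(\pm u,0)$; and let $f^1_{1,1}(x)=\sin x$. A Fučík system $F_{\alpha,\beta}$ is a sequence $\{f^n_{\alpha(n),\beta(n)}\}_{n\ge1}$ with $\alpha,\beta\colon\mathbb N\to\mathbb R$, $\alpha(1)=\beta(1)=1$ and $(\alpha(n),\beta(n))\in\Gamma_n$ for every $n\ge2$. A sequence $\{\psi_n\}_{n\ge1}$ in $L^2(0,\pi)$ is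 a Riesz basis if its linear span is dense and there are constants $c,C>0$ such that $$c\sum_{n=1}^N|a_n|^2\le\Big\|\sum_{n=1}^N a_n\psi_n\Big\|^2\le C\sum_{n=1}^N|a_n|^2$$ for all $N\in\mathbb N$ and all scalars $a_1,\dots,a_N$. **Theorem.** Let $F_{\alpha,\beta}$ be a Fučík system with $\alpha(n)=\beta(n)=n^2$ for every odd $n$. If $$\sum_{n=2}^\infty\left(\frac{\max(\sqrt{\alpha(n)},\sqrt{\beta(n)})}{n}-1\right)^2<\infty,$$ then $F_{\alpha,\beta}$ is a Riesz basis of $L^2(0,\pi)$ (over the real as well as the complex scalars). -/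

import Mathlib

open MeasureTheory

/-- The curve `Γ_n` (for `n ≥ 2`) of the Fučík spectrum of the Dirichlet Laplacian on `(0, π)`,
whose eigenfunctions have `n` bumps and start with a positive one. The positivity of `α` and `β`
is implicit in the occurrence of `π / √α` and `π / √β`, the lengths of the bumps. -/
def fucikCurve (n : ℕ) : Set (ℝ × ℝ) :=
  {p | 0 < p.1 ∧ 0 < p.2 ∧
    if Even n then
      (n : ℝ) / 2 * (Real.pi / √p.1) + (n : ℝ) / 2 * (Real.pi / √p.2) = Real.pi
    else
      ((n : ℝ) + 1) / 2 * (Real.pi / √p.1) + ((n : ℝ) - 1) / 2 * (Real.pi / √p.2) = Real.pi}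

/-- `u` is a classical solution, twice continuously differentiable on `[0, π]`, of
`-u'' = α u⁺ - β u⁻` in `(0, π)`, `u(0) = u(π) = 0`. -/
structure IsFucikSolution (α β : ℝ) (u : ℝ → ℝ) : Prop where
  contDiffOn : ContDiffOn ℝ 2 u (Set.Icc 0 Real.pi)
  equation : ∀ x ∈ Set.Ioo 0 Real.pi,
    -deriv (deriv u) x = α * max (u x) 0 - β * max (-u x) 0
  left_zero : u 0 = 0
  right_zero : u Real.pi = 0

/-- `u` is, on `[0, π]`, the normalized Fučík eigenfunction `f^n_{α,β}`. For `n ≥ 2` and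
`(α, β) ∈ Γ_n` it is the solution with positive (one-sided) derivative at `0` and sup-norm `1`;
for `n = 1` and `(α, β)` in the trivial part of the spectrum it is `sin`. -/
def IsNormalizedFucikEigenfunction (n : ℕ) (α β : ℝ) (u : ℝ → ℝ) : Prop :=
  (n = 1 ∧ (α = 1 ∨ β = 1) ∧ ∀ x ∈ Set.Icc 0 Real.pi, u x = Real.sin x) ∨
  (2 ≤ n ∧ (α, β) ∈ fucikCurve n ∧ IsFucikSolution α β u ∧
    0 < derivWithin u (Set.Icc 0 Real.pi) 0 ∧
    IsLUB ((fun x => |u x|) '' Set.Icc 0 Real.pi) 1)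

/-- `F` is the Fučík system `F_{α,β}`, that is, `F n` is (on `[0, π]`) the normalized Fučík
eigenfunction `f^n_{α(n),β(n)}` for `n = 1, 2, 3, …`. Values at `n = 0` are irrelevant. -/
structure IsFucikSystem (α β : ℕ → ℝ) (F : ℕ → ℝ → ℝ) : Prop where
  alpha_one : α 1 = 1
  beta_one : β 1 = 1
  mem_curve : ∀ n, 2 ≤ n → (α n, β n) ∈ fucikCurve n
  eigenfunction : ∀ n, 1 ≤ n → IsNormalizedFucikEigenfunction n (α n) (β n) (F n)

/-- A Riesz basis: a complete sequence (dense linear span) such that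
`c ∑ |aₙ|² ≤ ‖∑ aₙ ψₙ‖² ≤ C ∑ |aₙ|²` for all finite families of scalars, with some `c, C > 0`. -/
def IsRieszBasis (𝕜 : Type*) [RCLike 𝕜] {H : Type*} [NormedAddCommGroup H] [NormedSpace 𝕜 H]
    (ψ : ℕ → H) : Prop :=
  (Submodule.span 𝕜 (Set.range ψ)).topologicalClosure = ⊤ ∧
  ∃ c C : ℝ, 0 < c ∧ 0 < C ∧ ∀ (N : ℕ) (a : ℕ → 𝕜),
    c * ∑ n ∈ Finset.range N, ‖a n‖ ^ 2 ≤ ‖∑ n ∈ Finset.range N, a n • ψ n‖ ^ 2 ∧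
    ‖∑ n ∈ Finset.range N, a n • ψ n‖ ^ 2 ≤ C * ∑ n ∈ Finset.range N, ‖a n‖ ^ 2

/-- The sequence of real functions `f 1, f 2, f 3, …` lies in `L²((0, π); 𝕜)` (Lebesgue measure)
and is a Riesz basis of this space. -/
def IsRieszBasisL2 (𝕜 : Type*) [RCLike 𝕜] (f : ℕ → ℝ → ℝ) : Prop :=
  ∃ h : ∀ n : ℕ, MemLp (fun x => ((f (n + 1) x : ℝ) : 𝕜)) 2
      (volume.restrict (Set.Ioo 0 Real.pi)),
    IsRieszBasis 𝕜 (fun n => (h n).toLp (fun x => ((f (n + 1) x : ℝ) : 𝕜)))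

/-!
By Bari's theorem, an ω-independent sequence that is quadratically close to an orthonormal basis is
a Riesz basis. The orthonormal basis here is `√(2/π) sin nx`. Closeness comes from the explicit
formula for the eigenfunctions, which gives
`|fⁿ(x) - sin nx| ≤ (2 + π) (max(√α(n), √β(n)) / n - 1)`.

For ω-independence, the matrix `∫ sin(nx) fᵐ(x) dx` is triangular with nonzero diagonal once the
even indices are placed, in increasing order, before the odd ones. For odd `m`, `fᵐ` is `sin mx`.
For even `m`, `fᵐ` has period `2π/m`, so it is orthogonal to `sin nx` whenever `n` is even and not
a multiple of `m`. On the diagonal, each bump of `fⁿ` has a positive correlation with `sin nx`.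
-/

section RieszBasis

/-- A family is *ω-independent* if its only expansion of `0` is the trivial one. Convergence is
unconditional (`HasSum`), so that the index type needs no order. -/
def OmegaIndependent (𝕜 : Type*) {ι E : Type*} [Semiring 𝕜] [AddCommMonoid E] [Module 𝕜 E]
    [TopologicalSpace E] (ψ : ι → E) : Prop :=
  ∀ a : ι → 𝕜, HasSum (fun n => a n • ψ n) 0 → a = 0

theorem omegaIndependent_of_triangular {𝕜 ι κ E : Type*} [Ring 𝕜] [NoZeroDivisors 𝕜]
    [TopologicalSpace 𝕜] [T2Space 𝕜] [AddCommMonoid E] [Module 𝕜 E] [TopologicalSpace E]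
    [LT κ] [WellFoundedLT κ] (rank : ι → κ) (φ : ι → E →L[𝕜] 𝕜) {ψ : ι → E}
    (hdiag : ∀ n, φ n (ψ n) ≠ 0) (htri : ∀ n m, m ≠ n → ¬ rank m < rank n → φ n (ψ m) = 0) :
    OmegaIndependent 𝕜 ψ := by
  intro a ha
  ext n
  induction n using (InvImage.wf rank wellFounded_lt).induction with
  | _ n ih =>
    have hφ : HasSum (fun m => a m * φ n (ψ m)) 0 := by
      simpa only [map_smul, smul_eq_mul, map_zero] using (φ n).hasSum ha
    have hφn : HasSum (fun m => a m * φ n (ψ m)) (a n * φ n (ψ n)) := by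
      refine hasSum_single n fun m hmn => ?_
      by_cases hrank : rank m < rank n
      · rw [ih m hrank, Pi.zero_apply, zero_mul]
      · rw [htri n m hmn hrank, mul_zero]
    exact (mul_eq_zero.1 (hφn.unique hφ)).resolve_right (hdiag n)

theorem isUnit_one_add_of_isCompactOperator {𝕜 X : Type*} [NontriviallyNormedField 𝕜]
    [NormedAddCommGroup X] [NormedSpace 𝕜 X] [CompleteSpace X] {K : X →L[𝕜] X}
    (hK : IsCompactOperator K) (hinj : ∀ x, x + K x = 0 → x = 0) : IsUnit (1 + K) := by
  rcases hK.hasEigenvalue_or_mem_resolventSet (μ := (-1 : 𝕜)) (neg_ne_zero.2 one_ne_zero)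
    with heig | hres
  · obtain ⟨x, hx⟩ := heig.exists_hasEigenvector
    have hKx : K x = -x := by simpa using hx.apply_eq_smul
    exact absurd (hinj x (by rw [hKx, add_neg_cancel])) hx.2
  · have hneg : -(algebraMap 𝕜 (X →L[𝕜] X) (-1) - K) = 1 + K := by
      rw [map_neg, map_one, neg_sub, sub_neg_eq_add, add_comm]
    exact hneg ▸ (spectrum.mem_resolventSet_iff.1 hres).neg

variable {𝕜 H : Type*} [RCLike 𝕜] [NormedAddCommGroup H] [InnerProductSpace 𝕜 H]

section RankOneSum

open InnerProductSpace

variable {ι G : Type*} [NormedAddCommGroup G] [NormedSpace 𝕜 G]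

variable (𝕜) in
/-- The operator `x ↦ ∑ₙ ⟪eₙ, x⟫ gₙ`, as a sum in the operator norm. It is Hilbert–Schmidt when
`e` is orthonormal and `∑ₙ ‖gₙ‖² < ∞`; it is `0` by convention when the series diverges. -/
noncomputable def rankOneSum (g : ι → G) (e : ι → H) : H →L[𝕜] G :=
  ∑' n, rankOne 𝕜 (g n) (e n)

variable {e : ι → H} {g : ι → G}

theorem norm_sum_rankOne_le (he : Orthonormal 𝕜 e) (g : ι → G) (s : Finset ι) :
    ‖∑ n ∈ s, rankOne 𝕜 (g n) (e n)‖ ≤ √(∑ n ∈ s, ‖g n‖ ^ 2) := by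
  refine ContinuousLinearMap.opNorm_le_bound _ (Real.sqrt_nonneg _) fun x => ?_
  calc ‖(∑ n ∈ s, rankOne 𝕜 (g n) (e n)) x‖
      = ‖∑ n ∈ s, inner 𝕜 (e n) x • g n‖ := by
        simp only [FunLike.coe_sum, Finset.sum_apply, rankOne_apply]
    _ ≤ ∑ n ∈ s, ‖g n‖ * ‖inner 𝕜 (e n) x‖ :=
        norm_sum_le_of_le _ fun n _ => by rw [norm_smul, mul_comm]
    _ ≤ √(∑ n ∈ s, ‖g n‖ ^ 2) * √(∑ n ∈ s, ‖inner 𝕜 (e n) x‖ ^ 2) :=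
        Real.sum_mul_le_sqrt_mul_sqrt _ _ _
    _ ≤ √(∑ n ∈ s, ‖g n‖ ^ 2) * ‖x‖ := by
        gcongr
        exact Real.sqrt_le_iff.2 ⟨norm_nonneg _, he.sum_inner_products_le x⟩

theorem isCompactOperator_rankOne (x : G) (y : H) : IsCompactOperator (rankOne 𝕜 x y) :=
  (isCompactOperator_of_locallyCompactSpace_dom (innerSL 𝕜 y)).clm_comp
    (ContinuousLinearMap.toSpanSingleton 𝕜 x)

variable [CompleteSpace G]

theorem hasSum_rankOneSum (he : Orthonormal 𝕜 e) (hg : Summable fun n => ‖g n‖ ^ 2) :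
    HasSum (fun n => rankOne 𝕜 (g n) (e n)) (rankOneSum 𝕜 g e) := by
  refine (summable_iff_vanishing_norm.2 fun ε hε => ?_).hasSum
  obtain ⟨s, hs⟩ := summable_iff_vanishing_norm.1 hg (ε ^ 2) (by positivity)
  refine ⟨s, fun t ht => (norm_sum_rankOne_le he g t).trans_lt ?_⟩
  exact (Real.sqrt_lt' hε).2 ((le_abs_self _).trans_lt (hs t ht))

theorem hasSum_rankOneSum_apply (he : Orthonormal 𝕜 e) (hg : Summable fun n => ‖g n‖ ^ 2)
    (x : H) : HasSum (fun n => inner 𝕜 (e n) x • g n) (rankOneSum 𝕜 g e x) := by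
  simpa only [ContinuousLinearMap.apply_apply, rankOne_apply] using
    (ContinuousLinearMap.apply 𝕜 G x).hasSum (hasSum_rankOneSum he hg)

theorem rankOneSum_apply_self (he : Orthonormal 𝕜 e) (hg : Summable fun n => ‖g n‖ ^ 2) (m : ι) :
    rankOneSum 𝕜 g e (e m) = g m := by
  refine (hasSum_rankOneSum_apply he hg (e m)).unique ?_
  convert hasSum_single m fun n hn => ?_ using 1
  · rw [inner_self_eq_norm_sq_to_K, he.1 m, RCLike.ofReal_one, one_pow, one_smul]
  · rw [he.2 hn, zero_smul]

theorem isCompactOperator_rankOneSum (he : Orthonormal 𝕜 e) (hg : Summable fun n => ‖g n‖ ^ 2) :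
    IsCompactOperator (rankOneSum 𝕜 g e) := by
  refine isCompactOperator_of_tendsto (hasSum_rankOneSum he hg)
    (Filter.Eventually.of_forall fun s => ?_)
  induction s using Finset.cons_induction with
  | empty => simpa using isCompactOperator_zero
  | cons a s ha ih =>
    rw [Finset.sum_cons]
    exact (isCompactOperator_rankOne _ _).add ih

end RankOneSum

theorem norm_sum_smul_sq_of_orthonormal {ι : Type*} {e : ι → H} (he : Orthonormal 𝕜 e)
    (s : Finset ι) (a : ι → 𝕜) : ‖∑ n ∈ s, a n • e n‖ ^ 2 = ∑ n ∈ s, ‖a n‖ ^ 2 := by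
  simpa using he.orthogonalFamily.norm_sum a s

theorem isRieszBasis_map_hilbertBasis {E : Type*} [NormedAddCommGroup E] [NormedSpace 𝕜 E]
    (e : HilbertBasis ℕ 𝕜 H) (T : H ≃L[𝕜] E) : IsRieszBasis 𝕜 fun n => T (e n) := by
  set A := ‖(T.symm : E →L[𝕜] H)‖ ^ 2 + 1
  set B := ‖(T : H →L[𝕜] E)‖ ^ 2 + 1
  have hlower (x : H) : A⁻¹ * ‖x‖ ^ 2 ≤ ‖T x‖ ^ 2 := by
    have h : ‖x‖ ≤ ‖(T.symm : E →L[𝕜] H)‖ * ‖T x‖ := by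
      simpa using (T.symm : E →L[𝕜] H).le_opNorm (T x)
    rw [inv_mul_le_iff₀ (by positivity)]
    calc ‖x‖ ^ 2 ≤ (‖(T.symm : E →L[𝕜] H)‖ * ‖T x‖) ^ 2 := by gcongr
      _ ≤ A * ‖T x‖ ^ 2 := by rw [mul_pow]; gcongr; exact (lt_add_one _).le
  have hupper (x : H) : ‖T x‖ ^ 2 ≤ B * ‖x‖ ^ 2 := by
    calc ‖T x‖ ^ 2 ≤ (‖(T : H →L[𝕜] E)‖ * ‖x‖) ^ 2 := by
          gcongr; exact (T : H →L[𝕜] E).le_opNorm x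
      _ ≤ B * ‖x‖ ^ 2 := by rw [mul_pow]; gcongr; exact (lt_add_one _).le
  refine ⟨?_, A⁻¹, B, by positivity, by positivity, fun N a => ?_⟩
  · have hdense := T.surjective.denseRange.topologicalClosure_map_submodule
      (f := (T : H →L[𝕜] E)) e.dense_span
    rwa [Submodule.map_span, ← Set.range_comp] at hdense
  · have hmap : ∑ n ∈ Finset.range N, a n • T (e n) = T (∑ n ∈ Finset.range N, a n • e n) := by
      simp only [map_sum, map_smul]
    rw [hmap, ← norm_sum_smul_sq_of_orthonormal e.orthonormal]
    exact ⟨hlower _, hupper _⟩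

-- Bari's theorem. The operator sending `eₙ` to `ψₙ` is a Hilbert–Schmidt perturbation of the
-- identity, and ω-independence of `ψ` is its injectivity.
theorem isRieszBasis_of_omegaIndependent [CompleteSpace H] (e : HilbertBasis ℕ 𝕜 H) {ψ : ℕ → H}
    (hclose : Summable fun n => ‖ψ n - e n‖ ^ 2) (hind : OmegaIndependent 𝕜 ψ) :
    IsRieszBasis 𝕜 ψ := by
  set K : H →L[𝕜] H := rankOneSum 𝕜 (fun n => ψ n - e n) e
  have hsum (x : H) : HasSum (fun n => inner 𝕜 (e n) x • ψ n) (x + K x) := by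
    simpa only [HilbertBasis.repr_apply_apply, ← smul_add, add_sub_cancel] using
      (e.hasSum_repr x).add (hasSum_rankOneSum_apply e.orthonormal hclose x)
  have hinj (x : H) (hx : x + K x = 0) : x = 0 := by
    have hcoeff : (fun n => inner 𝕜 (e n) x) = 0 := hind _ (hx ▸ hsum x)
    refine e.repr.map_eq_zero_iff.1 (lp.ext (funext fun n => ?_))
    rw [HilbertBasis.repr_apply_apply]
    exact congrFun hcoeff n
  have hunit : IsUnit (1 + K) :=
    isUnit_one_add_of_isCompactOperator (isCompactOperator_rankOneSum e.orthonormal hclose) hinj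
  convert isRieszBasis_map_hilbertBasis e (ContinuousLinearEquiv.ofUnit hunit.unit) using 2 with n
  change ψ n = e n + K (e n)
  rw [rankOneSum_apply_self e.orthonormal hclose, add_sub_cancel]

theorem IsRieszBasis.of_smul {E : Type*} [NormedAddCommGroup E] [NormedSpace 𝕜 E] {ψ : ℕ → E}
    {c : 𝕜} (hc : c ≠ 0) (h : IsRieszBasis 𝕜 fun n => c • ψ n) : IsRieszBasis 𝕜 ψ := by
  obtain ⟨hdense, A, B, hA, hB, hbound⟩ := h
  have hc2 : 0 < ‖c‖ ^ 2 := pow_pos (norm_pos_iff.2 hc) 2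
  refine ⟨?_, A / ‖c‖ ^ 2, B / ‖c‖ ^ 2, by positivity, by positivity, fun N a => ?_⟩
  · rw [eq_top_iff, ← hdense]
    refine Submodule.topologicalClosure_mono (Submodule.span_le.2 ?_)
    rintro _ ⟨n, rfl⟩
    exact Submodule.smul_mem _ _ (Submodule.subset_span ⟨n, rfl⟩)
  · have hscale : ‖∑ n ∈ Finset.range N, a n • c • ψ n‖ ^ 2 =
        ‖∑ n ∈ Finset.range N, a n • ψ n‖ ^ 2 * ‖c‖ ^ 2 := by
      simp only [smul_comm _ c, ← Finset.smul_sum, norm_smul, mul_pow, mul_comm]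
    rw [div_mul_eq_mul_div, div_mul_eq_mul_div, div_le_iff₀ hc2, le_div_iff₀ hc2, ← hscale]
    exact hbound N a

end RieszBasis

section SineBasis

open Set Real

theorem integral_sin_mul_mul_sin_mul {a c : ℝ} (h : a ^ 2 ≠ c ^ 2) (T : ℝ) :
    ∫ t in 0..T, sin (a * t) * sin (c * t) =
      (a * cos (a * T) * sin (c * T) - c * sin (a * T) * cos (c * T)) / (c ^ 2 - a ^ 2) := by
  have hne : c ^ 2 - a ^ 2 ≠ 0 := sub_ne_zero.2 h.symm
  have hderiv (t : ℝ) : HasDerivAt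
      (fun t => (a * cos (a * t) * sin (c * t) - c * sin (a * t) * cos (c * t)) / (c ^ 2 - a ^ 2))
      (sin (a * t) * sin (c * t)) t := by
    have ha := (hasDerivAt_id t).const_mul a
    have hc := (hasDerivAt_id t).const_mul c
    refine ((((ha.cos.const_mul a).mul hc.sin).sub
      ((ha.sin.const_mul c).mul hc.cos)).div_const (c ^ 2 - a ^ 2)).congr_deriv ?_
    rw [div_eq_iff hne]
    simp only [id]
    ring
  rw [intervalIntegral.integral_eq_sub_of_hasDerivAt (fun t _ => hderiv t)
    (Continuous.intervalIntegrable (by fun_prop) _ _)]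
  simp

theorem integral_sin_mul_sq {a : ℝ} (ha : a ≠ 0) (T : ℝ) :
    ∫ t in 0..T, sin (a * t) ^ 2 = T / 2 - sin (a * T) * cos (a * T) / (2 * a) := by
  have hderiv (t : ℝ) : HasDerivAt (fun t => t / 2 - sin (a * t) * cos (a * t) / (2 * a))
      (sin (a * t) ^ 2) t := by
    have h := (hasDerivAt_id t).const_mul a
    refine (((hasDerivAt_id t).div_const 2).sub
      ((h.sin.mul h.cos).div_const (2 * a))).congr_deriv ?_
    simp only [id]
    field_simp
    linear_combination (-1 : ℝ) * sin_sq_add_cos_sq (a * t)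
  rw [intervalIntegral.integral_eq_sub_of_hasDerivAt (fun t _ => hderiv t)
    (Continuous.intervalIntegrable (by fun_prop) _ _)]
  simp

theorem integral_sin_nat_mul_sin_nat {m n : ℕ} (hn : n ≠ 0) :
    ∫ t in 0..π, sin (m * t) * sin (n * t) = if m = n then π / 2 else 0 := by
  split_ifs with h
  · subst h
    simp only [← sq]
    rw [integral_sin_mul_sq (Nat.cast_ne_zero.2 hn), sin_nat_mul_pi, zero_mul, zero_div, sub_zero]
  · have hsq : (m : ℝ) ^ 2 ≠ (n : ℝ) ^ 2 := by
      exact_mod_cast fun h' => h (Nat.pow_left_injective two_ne_zero h')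
    rw [integral_sin_mul_mul_sin_mul hsq, sin_nat_mul_pi, sin_nat_mul_pi]
    simp

theorem setIntegral_Ioo_eq_intervalIntegral {E : Type*} [NormedAddCommGroup E] [NormedSpace ℝ E]
    {a b : ℝ} (hab : a ≤ b) (f : ℝ → E) : ∫ x in Ioo a b, f x = ∫ x in a..b, f x := by
  rw [intervalIntegral.integral_of_le hab, integral_Ioc_eq_integral_Ioo]

section Completeness

theorem ae_eq_zero_of_fourierCoeffOn_eq_zero {a b : ℝ} (hab : a < b) {f : ℝ → ℂ}
    (hf : MemLp f 2 (volume.restrict (Ioc a b))) (hcoeff : ∀ n, fourierCoeffOn hab f n = 0) :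
    f =ᵐ[volume.restrict (Ioc a b)] 0 := by
  have hparseval : (b - a)⁻¹ • ∫ x in a..b, ‖f x‖ ^ 2 = 0 := by
    refine (hasSum_sq_fourierCoeffOn hab hf).unique ?_
    simpa only [hcoeff, norm_zero, ne_eq, two_ne_zero, not_false_eq_true, zero_pow] using
      hasSum_zero
  have hint : ∫ x in Ioc a b, ‖f x‖ ^ 2 = 0 := by
    rw [← intervalIntegral.integral_of_le hab.le]
    exact (smul_eq_zero.1 hparseval).resolve_left (inv_ne_zero (sub_pos.2 hab).ne')
  rw [integral_eq_zero_iff_of_nonneg (fun x => by positivity)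
    ((memLp_two_iff_integrable_sq_norm hf.1).1 hf)] at hint
  filter_upwards [hint] with x hx
  simpa using hx

theorem integral_exp_mul_sub_comp_neg (c T : ℝ) {k : ℝ → ℂ}
    (hk : IntervalIntegrable k volume (-T) T) :
    ∫ x in -T..T, Complex.exp (-(c * x) * Complex.I) * (k x - k (-x)) =
      -2 * Complex.I * ∫ x in -T..T, sin (c * x) * k x := by
  have hneg : IntervalIntegrable (fun x => k (-x)) volume (-T) T := by
    simpa only [neg_neg] using ((IntervalIntegrable.iff_comp_neg enorm_ne_top).1 hk).symm
  have hreflect : ∫ x in -T..T, Complex.exp (-(c * x) * Complex.I) * k (-x) =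
      ∫ x in -T..T, Complex.exp (c * x * Complex.I) * k x := by
    have h := intervalIntegral.integral_comp_neg (a := -T) (b := T)
      (fun x : ℝ => Complex.exp (c * x * Complex.I) * k x)
    rw [neg_neg] at h
    simpa only [Complex.ofReal_neg, mul_neg] using h
  simp only [mul_sub]
  rw [intervalIntegral.integral_sub (hk.continuousOn_mul (by fun_prop))
    (hneg.continuousOn_mul (by fun_prop)), hreflect,
    ← intervalIntegral.integral_sub (hk.continuousOn_mul (by fun_prop))
    (hk.continuousOn_mul (by fun_prop)), ← intervalIntegral.integral_const_mul]
  refine intervalIntegral.integral_congr fun x _ => ?_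
  simp only [Complex.exp_mul_I, Complex.cos_neg, Complex.sin_neg, Complex.ofReal_sin,
    Complex.ofReal_mul]
  ring

theorem fourierCoeffOn_sub_comp_neg {k : ℝ → ℂ} (hk : IntervalIntegrable k volume (-π) π) (n : ℤ) :
    fourierCoeffOn (neg_lt_self pi_pos) (fun x => k x - k (-x)) n =
      -Complex.I / π * ∫ x in -π..π, sin (n * x) * k x := by
  have hpi : (π : ℂ) ≠ 0 := Complex.ofReal_ne_zero.2 pi_ne_zero
  have hfourier (x : ℝ) : fourier (-n) (x : AddCircle (π - -π)) =
      Complex.exp (-((n : ℝ) * x) * Complex.I) := by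
    rw [fourier_coe_apply]
    congr 1
    push_cast
    field_simp
    ring
  simp only [fourierCoeffOn_eq_integral, hfourier, smul_eq_mul]
  rw [integral_exp_mul_sub_comp_neg _ _ hk, Complex.real_smul]
  push_cast
  field_simp
  ring

-- The odd extension of `g` to `(-π, π)` has vanishing Fourier coefficients.
theorem ae_eq_zero_of_integral_sin_mul_eq_zero {g : ℝ → ℝ}
    (hg : MemLp g 2 (volume.restrict (Ioo 0 π)))
    (h : ∀ n : ℕ, ∫ x in Ioo 0 π, sin ((n + 1 : ℕ) * x) * g x = 0) :
    g =ᵐ[volume.restrict (Ioo 0 π)] 0 := by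
  have hsub : Ioo 0 π ⊆ Ioc (-π) π :=
    Ioo_subset_Ioc_self.trans (Ioc_subset_Ioc_left (neg_lt_zero.2 pi_pos).le)
  set k : ℝ → ℂ := (Ioo 0 π).indicator fun x => (g x : ℂ)
  have hk2 : MemLp k 2 volume := (memLp_indicator_iff_restrict measurableSet_Ioo).2 hg.ofReal
  have hkint : IntervalIntegrable k volume (-π) π :=
    (intervalIntegrable_iff_integrableOn_Ioc_of_le (neg_le_self pi_pos.le)).2
      ((hk2.restrict _).integrable one_le_two)
  have hsin (n : ℤ) : ∫ x in Ioo 0 π, sin (n * x) * g x = 0 := by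
    obtain ⟨j, rfl | rfl⟩ := n.eq_nat_or_neg <;> rcases j with _ | j
    · simp
    · exact_mod_cast h j
    · simp
    · simp only [Int.cast_neg, Int.cast_natCast, neg_mul, sin_neg, integral_neg, h j, neg_zero]
  have hsink (n : ℤ) : ∫ x in -π..π, sin (n * x) * k x = 0 := by
    have hind (x : ℝ) : sin (n * x) * k x =
        (Ioo 0 π).indicator (fun x => ((sin (n * x) * g x : ℝ) : ℂ)) x := by
      by_cases hx : x ∈ Ioo 0 π <;> simp [k, hx]
    rw [intervalIntegral.integral_of_le (neg_le_self pi_pos.le)]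
    simp only [hind]
    rw [setIntegral_indicator measurableSet_Ioo, inter_eq_right.2 hsub, integral_complex_ofReal,
      hsin, Complex.ofReal_zero]
  have hzero := ae_eq_zero_of_fourierCoeffOn_eq_zero (neg_lt_self pi_pos)
    ((hk2.sub (hk2.comp_measurePreserving (Measure.measurePreserving_neg volume))).restrict _)
    fun n => (fourierCoeffOn_sub_comp_neg hkint n).trans (by rw [hsink, mul_zero])
  filter_upwards [ae_restrict_of_ae_restrict_of_subset hsub hzero,
    ae_restrict_mem measurableSet_Ioo] with x hx hmem
  have hneg : -x ∉ Ioo 0 π := fun h => (neg_pos.1 h.1).not_gt hmem.1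
  simpa [k, hmem, hneg] using hx

end Completeness

section ToL2

variable {X : Type*} [MeasurableSpace X] {μ : Measure X} {f g : X → ℝ}

variable (𝕜 : Type*) [RCLike 𝕜]

/-- A real square-integrable function as an element of `L²(μ; 𝕜)`. -/
noncomputable def toL2 (hf : MemLp f 2 μ) : Lp 𝕜 2 μ :=
  (hf.ofReal (K := 𝕜)).toLp

variable {𝕜}

theorem inner_toL2 (hf : MemLp f 2 μ) (g : Lp 𝕜 2 μ) :
    inner 𝕜 (toL2 𝕜 hf) g = ∫ x, (f x : 𝕜) * g x ∂μ := by
  rw [L2.inner_def]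
  refine integral_congr_ae ?_
  filter_upwards [(hf.ofReal (K := 𝕜)).coeFn_toLp] with x hx
  rw [toL2, hx, RCLike.inner_apply, RCLike.conj_ofReal, mul_comm]

theorem inner_toL2_toL2 (hf : MemLp f 2 μ) (hg : MemLp g 2 μ) :
    inner 𝕜 (toL2 𝕜 hf) (toL2 𝕜 hg) = ((∫ x, f x * g x ∂μ : ℝ) : 𝕜) := by
  rw [inner_toL2, ← integral_ofReal]
  refine integral_congr_ae ?_
  filter_upwards [(hg.ofReal (K := 𝕜)).coeFn_toLp] with x hx
  rw [toL2, hx, RCLike.ofReal_mul]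

theorem toL2_sub (hf : MemLp f 2 μ) (hg : MemLp g 2 μ) :
    toL2 𝕜 (hf.sub hg) = toL2 𝕜 hf - toL2 𝕜 hg := by
  rw [toL2, toL2, toL2, ← MemLp.toLp_sub]
  congr 1
  ext x
  simp

theorem norm_toL2_sq (hf : MemLp f 2 μ) : ‖toL2 𝕜 hf‖ ^ 2 = ∫ x, f x ^ 2 ∂μ := by
  rw [← inner_self_eq_norm_sq (𝕜 := 𝕜), inner_toL2_toL2, RCLike.ofReal_re]
  simp only [sq]

end ToL2

variable (𝕜 : Type*) [RCLike 𝕜]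

theorem memLp_sin (c : ℝ) (μ : Measure ℝ) [IsFiniteMeasure μ] : MemLp (fun x => sin (c * x)) 2 μ :=
  MemLp.of_bound (by fun_prop) 1 (Filter.Eventually.of_forall fun _ => abs_sin_le_one _)

/-- The function `√(2/π) sin (n + 1)x`, as a vector of `L²((0, π); 𝕜)`. -/
noncomputable def normalizedSine (n : ℕ) : Lp 𝕜 2 (volume.restrict (Ioo 0 π)) :=
  (√(2 / π) : 𝕜) • toL2 𝕜 (memLp_sin (n + 1 : ℕ) _)

theorem orthonormal_normalizedSine : Orthonormal 𝕜 (normalizedSine 𝕜) := by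
  rw [orthonormal_iff_ite]
  intro m n
  rw [normalizedSine, normalizedSine, inner_smul_left, inner_smul_right, inner_toL2_toL2,
    setIntegral_Ioo_eq_intervalIntegral pi_pos.le, integral_sin_nat_mul_sin_nat n.succ_ne_zero,
    RCLike.conj_ofReal, ← RCLike.ofReal_mul, ← RCLike.ofReal_mul, ← mul_assoc,
    mul_self_sqrt (by positivity)]
  rcases eq_or_ne m n with rfl | hmn
  · rw [if_pos rfl, if_pos rfl, div_mul_div_cancel₀ pi_ne_zero, div_self two_ne_zero,
      RCLike.ofReal_one]
  · simp [hmn]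

theorem orthogonal_span_normalizedSine_eq_bot :
    (Submodule.span 𝕜 (range (normalizedSine 𝕜)))ᗮ = ⊥ := by
  have hscale : (√(2 / π) : 𝕜) ≠ 0 := RCLike.ofReal_ne_zero.2 (by positivity)
  refine (Submodule.eq_bot_iff _).2 fun g hg => ?_
  have hg2 : MemLp g 2 (volume.restrict (Ioo 0 π)) := Lp.memLp g
  have hortho (n : ℕ) : ∫ x in Ioo 0 π, (sin ((n + 1 : ℕ) * x) : 𝕜) * g x = 0 := by
    have h := (Submodule.mem_orthogonal _ _).1 hg _ (Submodule.subset_span ⟨n, rfl⟩)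
    rw [normalizedSine, inner_smul_left, inner_toL2] at h
    exact (mul_eq_zero.1 h).resolve_left ((map_ne_zero _).2 hscale)
  have hint (n : ℕ) : Integrable (fun x => (sin ((n + 1 : ℕ) * x) : 𝕜) * g x)
      (volume.restrict (Ioo 0 π)) :=
    (memLp_sin (n + 1 : ℕ) _).ofReal.integrable_mul hg2
  have hre : (fun x => RCLike.re (g x)) =ᵐ[volume.restrict (Ioo 0 π)] 0 := by
    refine ae_eq_zero_of_integral_sin_mul_eq_zero hg2.re fun n => ?_
    have h := congrArg RCLike.re (hortho n)
    rw [← integral_re (hint n)] at h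
    simpa only [RCLike.re_ofReal_mul, map_zero] using h
  have him : (fun x => RCLike.im (g x)) =ᵐ[volume.restrict (Ioo 0 π)] 0 := by
    refine ae_eq_zero_of_integral_sin_mul_eq_zero hg2.im fun n => ?_
    have h := congrArg RCLike.im (hortho n)
    rw [← integral_im (hint n)] at h
    simpa only [RCLike.im_ofReal_mul, map_zero] using h
  rw [Lp.eq_zero_iff_ae_eq_zero]
  filter_upwards [hre, him] with x hxre hxim
  exact RCLike.ext (by simpa using hxre) (by simpa using hxim)

/-- The orthonormal basis `√(2/π) sin x, √(2/π) sin 2x, …` of `L²((0, π); 𝕜)`. -/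
noncomputable def sineBasis : HilbertBasis ℕ 𝕜 (Lp 𝕜 2 (volume.restrict (Ioo 0 π))) :=
  HilbertBasis.mkOfOrthogonalEqBot (orthonormal_normalizedSine 𝕜)
    (orthogonal_span_normalizedSine_eq_bot 𝕜)

theorem coe_sineBasis : ⇑(sineBasis 𝕜) = normalizedSine 𝕜 :=
  HilbertBasis.coe_mkOfOrthogonalEqBot _ _

theorem isRieszBasisL2_of_triangular {κ : Type*} [LT κ] [WellFoundedLT κ] {f : ℕ → ℝ → ℝ}
    (hf : ∀ n, MemLp (f (n + 1)) 2 (volume.restrict (Ioo 0 π)))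
    (hclose : Summable fun n : ℕ => ∫ x in 0..π, (f (n + 1) x - sin ((n + 1 : ℕ) * x)) ^ 2)
    (rank : ℕ → κ) (hdiag : ∀ n : ℕ, ∫ x in 0..π, sin ((n + 1 : ℕ) * x) * f (n + 1) x ≠ 0)
    (htri : ∀ n m : ℕ, m ≠ n → ¬ rank m < rank n →
      ∫ x in 0..π, sin ((n + 1 : ℕ) * x) * f (m + 1) x = 0) :
    IsRieszBasisL2 𝕜 f := by
  simp only [← setIntegral_Ioo_eq_intervalIntegral pi_pos.le] at hclose hdiag htri
  refine ⟨fun n => (hf n).ofReal, ?_⟩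
  change IsRieszBasis 𝕜 fun n => toL2 𝕜 (hf n)
  have hscale : (√(2 / π) : 𝕜) ≠ 0 := RCLike.ofReal_ne_zero.2 (by positivity)
  refine IsRieszBasis.of_smul hscale (isRieszBasis_of_omegaIndependent (sineBasis 𝕜) ?_
    (omegaIndependent_of_triangular rank
      (fun n => innerSL 𝕜 (toL2 𝕜 (memLp_sin (n + 1 : ℕ) _))) ?_ ?_))
  · refine (hclose.mul_left (√(2 / π) ^ 2)).congr fun n => ?_
    rw [coe_sineBasis, normalizedSine, ← smul_sub, ← toL2_sub, norm_smul, mul_pow, norm_toL2_sq,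
      RCLike.norm_ofReal, sq_abs]
    rfl
  · intro n
    rw [innerSL_apply_apply, inner_smul_right, inner_toL2_toL2]
    exact mul_ne_zero hscale (RCLike.ofReal_ne_zero.2 (hdiag n))
  · intro n m hmn hrank
    rw [innerSL_apply_apply, inner_smul_right, inner_toL2_toL2, htri n m hmn hrank,
      RCLike.ofReal_zero, mul_zero]

end SineBasis

section FucikEquation

open Set Real

/-- The vector field of `u'' = -(α u⁺ - β u⁻)`, written as a first-order system for `(u, u')`. -/
def fucikField (α β : ℝ) (z : ℝ × ℝ) : ℝ × ℝ :=
  (z.2, -(α * max z.1 0 - β * max (-z.1) 0))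

theorem exists_lipschitzWith_fucikField (α β : ℝ) : ∃ K, LipschitzWith K (fucikField α β) :=
  have hpos := (lipschitzWith_smul α).comp (LipschitzWith.prod_fst.max_const 0)
  have hneg := (lipschitzWith_smul β).comp (LipschitzWith.prod_fst.neg.max_const 0)
  ⟨_, LipschitzWith.prod_snd.prodMk (hpos.sub hneg).neg⟩

/-- The trajectory `x ↦ (u x, u' x)` of `u : [0, π] → ℝ` in the phase plane, with one-sided
derivatives at `0` and `π`. -/
noncomputable def phase (u : ℝ → ℝ) (x : ℝ) : ℝ × ℝ :=
  (u x, derivWithin u (Icc 0 π) x)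

theorem hasDerivAt_mul_sin_shift (c a p x : ℝ) :
    HasDerivAt (fun x => c * sin (a * (x - p))) (c * a * cos (a * (x - p))) x := by
  refine (((hasDerivAt_id x).sub_const p).const_mul a).sin.const_mul c |>.congr_deriv ?_
  rw [id, mul_one, mul_comm (cos _), mul_assoc]

theorem hasDerivAt_mul_cos_shift (c a p x : ℝ) :
    HasDerivAt (fun x => c * a * cos (a * (x - p))) (-(a ^ 2 * (c * sin (a * (x - p))))) x := by
  refine (((hasDerivAt_id x).sub_const p).const_mul a).cos.const_mul (c * a) |>.congr_deriv ?_
  rw [id]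
  ring

namespace IsFucikSolution

variable {α β : ℝ} {u : ℝ → ℝ}

theorem hasDerivWithinAt_derivWithin (h : IsFucikSolution α β u) {x : ℝ} (hx : x ∈ Icc 0 π) :
    HasDerivWithinAt (derivWithin u (Icc 0 π)) (-(α * max (u x) 0 - β * max (-u x) 0))
      (Icc 0 π) x := by
  have huniq : UniqueDiffOn ℝ (Icc 0 π) := uniqueDiffOn_Icc pi_pos
  have hcont := h.contDiffOn.continuousOn
  have hu' : ContDiffOn ℝ 1 (derivWithin u (Icc 0 π)) (Icc 0 π) :=
    h.contDiffOn.derivWithin huniq (by norm_num)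
  have hinterior : EqOn (derivWithin (derivWithin u (Icc 0 π)) (Icc 0 π))
      (fun x => -(α * max (u x) 0 - β * max (-u x) 0)) (Ioo 0 π) := by
    intro y hy
    change _ = -(α * max (u y) 0 - β * max (-u y) 0)
    rw [← h.equation y hy, neg_neg, derivWithin_of_mem_nhds (Icc_mem_nhds hy.1 hy.2)]
    refine Filter.EventuallyEq.deriv_eq ?_
    filter_upwards [Ioo_mem_nhds hy.1 hy.2] with z hz
    exact derivWithin_of_mem_nhds (Icc_mem_nhds hz.1 hz.2)
  have hclosed := hinterior.of_subset_closure (hu'.continuousOn_derivWithin huniq le_rfl)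
    (by fun_prop) Ioo_subset_Icc_self (closure_Ioo pi_pos.ne).ge
  have hderiv := (hu'.differentiableOn one_ne_zero x hx).hasDerivWithinAt
  rwa [hclosed hx] at hderiv

theorem hasDerivWithinAt_phase (h : IsFucikSolution α β u) {x : ℝ} (hx : x ∈ Icc 0 π) :
    HasDerivWithinAt (phase u) (fucikField α β (phase u x)) (Icc 0 π) x :=
  (h.contDiffOn.differentiableOn two_ne_zero x hx).hasDerivWithinAt.prodMk
    (h.hasDerivWithinAt_derivWithin hx)

theorem phase_eqOn (h : IsFucikSolution α β u) {w : ℝ → ℝ × ℝ} {p q : ℝ} (hp : 0 ≤ p)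
    (hq : q ≤ π) (hw : ∀ x ∈ Icc p q, HasDerivAt w (fucikField α β (w x)) x)
    (hpw : phase u p = w p) : EqOn (phase u) w (Icc p q) := by
  obtain ⟨K, hK⟩ := exists_lipschitzWith_fucikField α β
  have hsub : Icc p q ⊆ Icc 0 π := Icc_subset_Icc hp hq
  have hnhds {x : ℝ} (hx : x ∈ Ico p q) : Icc 0 π ∈ nhdsWithin x (Ici x) :=
    Filter.mem_of_superset (Icc_mem_nhdsGE (hx.2.trans_le hq)) (Icc_subset_Icc_left (hp.trans hx.1))
  exact ODE_solution_unique (v := fun _ => fucikField α β) (fun _ => hK)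
    (fun x hx => (h.hasDerivWithinAt_phase (hsub hx)).continuousWithinAt.mono hsub)
    (fun x hx => (h.hasDerivWithinAt_phase (hsub (Ico_subset_Icc_self hx))).mono_of_mem_nhdsWithin
      (hnhds hx))
    (fun x hx => (hw x hx).continuousAt.continuousWithinAt)
    (fun x hx => (hw x (Ico_subset_Icc_self hx)).hasDerivWithinAt) hpw

-- Where the field acts on `c sin (a (x - p))` as `-a²`, that sine is the solution.
theorem phase_eq_sin_shift (h : IsFucikSolution α β u) {a c p q : ℝ} (hp : 0 ≤ p) (hq : q ≤ π)
    (hforce : ∀ x ∈ Icc p q, α * max (c * sin (a * (x - p))) 0 -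
      β * max (-(c * sin (a * (x - p)))) 0 = a ^ 2 * (c * sin (a * (x - p))))
    (hpu : phase u p = (0, c * a)) {x : ℝ} (hx : x ∈ Icc p q) :
    phase u x = (c * sin (a * (x - p)), c * a * cos (a * (x - p))) := by
  refine h.phase_eqOn (w := fun x => (c * sin (a * (x - p)), c * a * cos (a * (x - p)))) hp hq
    (fun y hy => ?_) (by simp [hpu]) hx
  refine ((hasDerivAt_mul_sin_shift c a p y).prodMk
    (hasDerivAt_mul_cos_shift c a p y)).congr_deriv ?_
  rw [fucikField, hforce y hy]

theorem eq_sin {n : ℝ} (h : IsFucikSolution (n ^ 2) (n ^ 2) u) (hn : n ≠ 0) {x : ℝ}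
    (hx : x ∈ Icc 0 π) : u x = derivWithin u (Icc 0 π) 0 / n * sin (n * x) := by
  have hphase := h.phase_eq_sin_shift (a := n) (c := derivWithin u (Icc 0 π) 0 / n) le_rfl le_rfl
    (fun y _ => by rw [← mul_sub, max_zero_sub_max_neg_zero_eq_self])
    (by rw [phase, h.left_zero, div_mul_cancel₀ _ hn]) hx
  have hu : u x = derivWithin u (Icc 0 π) 0 / n * sin (n * (x - 0)) := congrArg Prod.fst hphase
  rwa [sub_zero] at hu

theorem phase_eq_of_phase_eq_pos {a : ℝ} (h : IsFucikSolution (a ^ 2) β u) (ha : 0 < a)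
    {p d : ℝ} (hd : 0 ≤ d) (hp : 0 ≤ p) (hq : p + π / a ≤ π) (hpu : phase u p = (0, d)) {x : ℝ}
    (hx : x ∈ Icc p (p + π / a)) :
    phase u x = (d / a * sin (a * (x - p)), d * cos (a * (x - p))) := by
  have hda : d / a * a = d := div_mul_cancel₀ d ha.ne'
  have hphase := h.phase_eq_sin_shift (a := a) (c := d / a) hp hq (fun y hy => ?_)
    (by rw [hpu, hda]) hx
  · rwa [hda] at hphase
  · have hbump : 0 ≤ d / a * sin (a * (y - p)) :=
      mul_nonneg (by positivity) (sin_nonneg_of_nonneg_of_le_pi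
        (mul_nonneg ha.le (sub_nonneg.2 hy.1))
        ((le_div_iff₀' ha).1 (sub_le_iff_le_add'.2 hy.2)))
    rw [max_eq_left hbump, max_eq_right (neg_nonpos.2 hbump), mul_zero, sub_zero]

theorem phase_eq_of_phase_eq_neg {b : ℝ} (h : IsFucikSolution α (b ^ 2) u) (hb : 0 < b)
    {p d : ℝ} (hd : 0 ≤ d) (hp : 0 ≤ p) (hq : p + π / b ≤ π) (hpu : phase u p = (0, -d)) {x : ℝ}
    (hx : x ∈ Icc p (p + π / b)) :
    phase u x = (-(d / b) * sin (b * (x - p)), -d * cos (b * (x - p))) := by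
  have hdb : -(d / b) * b = -d := by rw [neg_mul, div_mul_cancel₀ d hb.ne']
  have hphase := h.phase_eq_sin_shift (a := b) (c := -(d / b)) hp hq (fun y hy => ?_)
    (by rw [hpu, hdb]) hx
  · rwa [hdb] at hphase
  · have hbump : 0 ≤ d / b * sin (b * (y - p)) :=
      mul_nonneg (by positivity) (sin_nonneg_of_nonneg_of_le_pi
        (mul_nonneg hb.le (sub_nonneg.2 hy.1))
        ((le_div_iff₀' hb).1 (sub_le_iff_le_add'.2 hy.2)))
    rw [neg_mul, neg_neg, max_eq_right (neg_nonpos.2 hbump), max_eq_left hbump]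
    ring

end IsFucikSolution

/-- The length of a positive bump of frequency `a` followed by a negative one of frequency `b`. -/
noncomputable def fucikPeriod (a b : ℝ) : ℝ := π / a + π / b

/-- One period of the Fučík eigenfunction with slope `d` at `0`: a positive bump of frequency `a`
and a negative bump of frequency `b`. -/
noncomputable def fucikWave (a b d t : ℝ) : ℝ :=
  if t ≤ π / a then d / a * sin (a * t) else d / b * sin (b * (t - fucikPeriod a b))

variable {a b d : ℝ}

theorem fucikPeriod_pos (ha : 0 < a) (hb : 0 < b) : 0 < fucikPeriod a b := by
  rw [fucikPeriod]; positivity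

theorem sin_mul_sub_fucikPeriod (a : ℝ) (hb : b ≠ 0) (t : ℝ) :
    sin (b * (t - fucikPeriod a b)) = -sin (b * (t - π / a)) := by
  rw [← sin_sub_pi]
  congr 1
  rw [fucikPeriod]
  field_simp
  ring

theorem fucikWave_of_le (b d : ℝ) {t : ℝ} (ht : t ≤ π / a) :
    fucikWave a b d t = d / a * sin (a * t) := if_pos ht

theorem fucikWave_of_ge (ha : a ≠ 0) (hb : b ≠ 0) (d : ℝ) {t : ℝ} (ht : π / a ≤ t) :
    fucikWave a b d t = d / b * sin (b * (t - fucikPeriod a b)) := by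
  rcases ht.lt_or_eq with ht | rfl
  · exact if_neg ht.not_ge
  · rw [fucikWave_of_le _ _ le_rfl, mul_div_cancel₀ _ ha, sin_mul_sub_fucikPeriod a hb]
    simp

namespace IsFucikSolution

variable {u : ℝ → ℝ}

theorem phase_add_pi_div (h : IsFucikSolution (a ^ 2) (b ^ 2) u) (ha : 0 < a) (hd : 0 ≤ d)
    {p : ℝ} (hp : 0 ≤ p) (hq : p + π / a ≤ π) (hpu : phase u p = (0, d)) :
    phase u (p + π / a) = (0, -d) := by
  have hend := right_mem_Icc.2 (le_add_of_nonneg_right (a := p) (by positivity : 0 ≤ π / a))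
  rw [h.phase_eq_of_phase_eq_pos ha hd hp hq hpu hend, add_sub_cancel_left,
    mul_div_cancel₀ _ ha.ne']
  simp

theorem phase_add_fucikPeriod (h : IsFucikSolution (a ^ 2) (b ^ 2) u) (ha : 0 < a) (hb : 0 < b)
    (hd : 0 ≤ d) {p : ℝ} (hp : 0 ≤ p) (hq : p + fucikPeriod a b ≤ π) (hpu : phase u p = (0, d)) :
    phase u (p + fucikPeriod a b) = (0, d) := by
  have hpa : 0 < π / a := by positivity
  have hpb : 0 < π / b := by positivity
  rw [fucikPeriod, ← add_assoc] at hq ⊢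
  rw [h.phase_eq_of_phase_eq_neg hb hd (by linarith) hq
    (h.phase_add_pi_div ha hd hp (by linarith) hpu) (right_mem_Icc.2 (by linarith)),
    add_sub_cancel_left, mul_div_cancel₀ _ hb.ne']
  simp

theorem phase_nat_mul_fucikPeriod (h : IsFucikSolution (a ^ 2) (b ^ 2) u) (ha : 0 < a) (hb : 0 < b)
    (hd : 0 ≤ d) (hslope : derivWithin u (Icc 0 π) 0 = d) (k : ℕ)
    (hk : k * fucikPeriod a b ≤ π) : phase u (k * fucikPeriod a b) = (0, d) := by
  have hP := fucikPeriod_pos ha hb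
  induction k with
  | zero => rw [Nat.cast_zero, zero_mul, phase, h.left_zero, hslope]
  | succ k ih =>
    rw [Nat.cast_succ, add_one_mul] at hk ⊢
    exact h.phase_add_fucikPeriod ha hb hd (by positivity) hk (ih (by linarith))

theorem eq_fucikWave (h : IsFucikSolution (a ^ 2) (b ^ 2) u) (ha : 0 < a) (hb : 0 < b)
    (hd : 0 ≤ d) (hslope : derivWithin u (Icc 0 π) 0 = d) {k : ℕ}
    (hk : k * fucikPeriod a b + fucikPeriod a b ≤ π) {t : ℝ} (ht : t ∈ Icc 0 (fucikPeriod a b)) :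
    u (k * fucikPeriod a b + t) = fucikWave a b d t := by
  have hP := fucikPeriod_pos ha hb
  have hpa : 0 < π / a := by positivity
  have hpb : 0 < π / b := by positivity
  set p := k * fucikPeriod a b
  have hp : 0 ≤ p := by positivity
  have hPab : p + fucikPeriod a b = p + π / a + π / b := (add_assoc _ _ _).symm
  have hpu : phase u p = (0, d) := h.phase_nat_mul_fucikPeriod ha hb hd hslope k (by linarith)
  rcases le_total t (π / a) with hta | hta
  · have hphase := h.phase_eq_of_phase_eq_pos ha hd hp (by linarith) hpu (x := p + t)
      ⟨by linarith [ht.1], by linarith⟩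
    have hu : u (p + t) = d / a * sin (a * (p + t - p)) := congrArg Prod.fst hphase
    rw [fucikWave_of_le _ _ hta, hu, add_sub_cancel_left]
  · have hphase := h.phase_eq_of_phase_eq_neg hb hd (by linarith) (by linarith)
      (h.phase_add_pi_div ha hd hp (by linarith) hpu) (x := p + t)
      ⟨by linarith, by linarith [ht.2]⟩
    have hu : u (p + t) = -(d / b) * sin (b * (p + t - (p + π / a))) := congrArg Prod.fst hphase
    rw [fucikWave_of_ge ha.ne' hb.ne' _ hta, hu, sin_mul_sub_fucikPeriod a hb.ne',
      add_sub_add_left_eq_sub]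
    ring

end IsFucikSolution

end FucikEquation

section FucikPeriodic

open Set Real

variable {a b d n : ℝ}

theorem continuous_fucikWave (ha : a ≠ 0) (hb : b ≠ 0) (d : ℝ) : Continuous (fucikWave a b d) := by
  refine Continuous.if_le (by fun_prop) (by fun_prop) continuous_id continuous_const ?_
  rintro t rfl
  rw [← fucikWave_of_le b d le_rfl, fucikWave_of_ge ha hb d le_rfl]

theorem abs_fucikWave_le (ha : 0 < a) (hb : 0 < b) (hd : 0 ≤ d) (t : ℝ) :
    |fucikWave a b d t| ≤ max (d / a) (d / b) := by
  have hbump (c : ℝ) (hc : 0 < c) (s : ℝ) : |d / c * sin s| ≤ d / c := by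
    rw [abs_mul, abs_of_nonneg (by positivity)]
    exact mul_le_of_le_one_right (by positivity) (abs_sin_le_one _)
  rw [fucikWave]
  split_ifs
  · exact (hbump a ha _).trans (le_max_left _ _)
  · exact (hbump b hb _).trans (le_max_right _ _)

/-- The periodic extension to `ℝ` of `fucikWave a b d` from `[0, fucikPeriod a b)`. -/
noncomputable def fucikPeriodic (a b d x : ℝ) : ℝ :=
  fucikWave a b d (fucikPeriod a b * Int.fract (x / fucikPeriod a b))

theorem periodic_fucikPeriodic (hP : fucikPeriod a b ≠ 0) (d : ℝ) :
    Function.Periodic (fucikPeriodic a b d) (fucikPeriod a b) := by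
  intro x
  rw [fucikPeriodic, add_div, div_self hP, Int.fract_add_one, fucikPeriodic]

theorem fucikPeriodic_of_mem_Ico (hP : 0 < fucikPeriod a b) (d : ℝ) {t : ℝ}
    (ht : t ∈ Ico 0 (fucikPeriod a b)) : fucikPeriodic a b d t = fucikWave a b d t := by
  rw [fucikPeriodic, Int.fract_eq_self.2 ⟨div_nonneg ht.1 hP.le, (div_lt_one hP).2 ht.2⟩,
    mul_div_cancel₀ _ hP.ne']

theorem intervalIntegrable_fucikPeriodic (ha : 0 < a) (hb : 0 < b) (d s t : ℝ) :
    IntervalIntegrable (fucikPeriodic a b d) volume s t := by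
  have hP := fucikPeriod_pos ha hb
  refine (periodic_fucikPeriodic hP.ne' d).intervalIntegrable₀ hP.ne' ?_ s t
  refine ((continuous_fucikWave ha.ne' hb.ne' d).intervalIntegrable 0 _).congr_uIoo fun x hx => ?_
  rw [uIoo_of_le hP.le] at hx
  exact (fucikPeriodic_of_mem_Ico hP d (Ioo_subset_Ico_self hx)).symm

theorem periodic_sin_mul (h : n * fucikPeriod a b = 2 * π) :
    Function.Periodic (fun x => sin (n * x)) (fucikPeriod a b) := by
  intro x
  simp only [mul_add, h, sin_add_two_pi]

theorem div_add_div_eq_two (h : n * fucikPeriod a b = 2 * π) : n / a + n / b = 2 := by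
  refine mul_left_cancel₀ pi_ne_zero ?_
  rw [fucikPeriod] at h
  linear_combination h

theorem pos_of_mul_fucikPeriod (ha : 0 < a) (hb : 0 < b) (h : n * fucikPeriod a b = 2 * π) :
    0 < n :=
  pos_of_mul_pos_left (h ▸ two_pi_pos) (fucikPeriod_pos ha hb).le

theorem integral_eq_zero_of_shift_eq_smul {E : Type*} [NormedAddCommGroup E] [NormedSpace ℂ E]
    {f : ℝ → E} {T : ℝ} {ζ : ℂ} {m : ℕ} (hf : ∀ x, f (x + T) = ζ • f x) (hζm : ζ ^ m = 1)
    (hζ : ζ ≠ 1) : ∫ x in 0..m * T, f x = 0 := by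
  have hiterate (k : ℕ) (x : ℝ) : f (x + k * T) = ζ ^ k • f x := by
    induction k with
    | zero => rw [Nat.cast_zero, zero_mul, add_zero, pow_zero, one_smul]
    | succ k ih => rw [Nat.cast_succ, add_one_mul, ← add_assoc, hf, ih, smul_smul, ← pow_succ']
  have hperiodic : Function.Periodic f (m * T) := fun x => by rw [hiterate, hζm, one_smul]
  have hshift : ζ • ∫ x in 0..m * T, f x = ∫ x in 0..m * T, f x := calc
    ζ • ∫ x in 0..m * T, f x = ∫ x in 0..m * T, f (x + T) := by
      simp only [hf, intervalIntegral.integral_smul]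
    _ = ∫ x in T..T + m * T, f x := by
      rw [intervalIntegral.integral_comp_add_right, zero_add, add_comm T]
    _ = ∫ x in 0..m * T, f x := by rw [hperiodic.intervalIntegral_add_eq T 0, zero_add]
  refine (smul_eq_zero.1 ?_).resolve_left (sub_ne_zero.2 hζ)
  rw [sub_smul, one_smul, hshift, sub_self]

theorem integral_sin_mul_periodic_eq_zero {V : ℝ → ℝ} {T : ℝ} {m i : ℕ} (hT : m * T = π)
    (hV : Function.Periodic V T) (hint : IntervalIntegrable V volume 0 π) (hmi : ¬ m ∣ i) :
    ∫ x in 0..π, sin ((2 * i : ℕ) * x) * V x = 0 := by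
  have hm : m ≠ 0 := fun h => pi_ne_zero (by rw [← hT, h, Nat.cast_zero, zero_mul])
  set ω := Complex.exp (2 * π * Complex.I / m)
  have hω : IsPrimitiveRoot ω m := Complex.isPrimitiveRoot_exp m hm
  set e : ℝ → ℂ := fun x => Complex.exp (((2 * i : ℕ) * x : ℝ) * Complex.I) with he
  have he_add (x y : ℝ) : e (x + y) = e x * e y := by
    simp only [he, mul_add, Complex.ofReal_add, add_mul, Complex.exp_add]
  have heT : e T = ω ^ i := by
    rw [he, ← Complex.exp_nat_mul, ← hT]
    push_cast
    field_simp
  have hzero : ∫ x in 0..m * T, e x * V x = 0 := by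
    refine integral_eq_zero_of_shift_eq_smul (ζ := ω ^ i) (fun x => ?_) ?_
      (mt (hω.pow_eq_one_iff_dvd i).1 hmi)
    · rw [he_add, heT, hV, smul_eq_mul, mul_comm (e x), mul_assoc]
    · rw [pow_right_comm, hω.pow_eq_one, one_pow]
  have heV : IntervalIntegrable (fun x => e x * V x) volume 0 π :=
    IntervalIntegrable.continuousOn_mul ⟨hint.1.ofReal, hint.2.ofReal⟩ (by fun_prop)
  have him := Complex.imCLM.intervalIntegral_comp_comm heV
  rw [← hT, hzero, map_zero, hT] at him
  simpa only [he, Complex.imCLM_apply, Complex.im_mul_ofReal, Complex.exp_ofReal_mul_I_im] using him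

theorem integral_sin_bump_mul_sin_pos (ha : 0 < a) (hn : 0 < n) (hna : n < 2 * a) :
    0 < ∫ t in 0..π / a, sin (a * t) * sin (n * t) := by
  have haπ : a * (π / a) = π := mul_div_cancel₀ _ ha.ne'
  rcases eq_or_ne a n with rfl | hne
  · simp only [← sq]
    rw [integral_sin_mul_sq ha.ne', haπ, sin_pi, zero_mul, zero_div, sub_zero]
    positivity
  set θ := n * (π / a) with hθ
  have hθn : a * θ = n * π := by rw [hθ, mul_left_comm, haπ]
  have hsq : a ^ 2 ≠ n ^ 2 := fun h => hne ((sq_eq_sq₀ ha.le hn.le).1 h)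
  have hvalue : ∫ t in 0..π / a, sin (a * t) * sin (n * t) = a * sin θ / (a ^ 2 - n ^ 2) := by
    rw [integral_sin_mul_mul_sin_mul hsq, haπ, sin_pi, cos_pi, ← neg_sub (a ^ 2), div_neg,
      ← neg_div]
    ring
  rw [hvalue]
  have hθ2 : θ < 2 * π := lt_of_mul_lt_mul_left (by nlinarith [pi_pos]) ha.le
  rcases hne.lt_or_gt with han | han
  · have hπθ : π < θ := lt_of_mul_lt_mul_left (by nlinarith [pi_pos]) ha.le
    have hsin : sin θ < 0 := by
      rw [← neg_pos, ← sin_sub_pi]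
      exact sin_pos_of_pos_of_lt_pi (by linarith) (by linarith)
    exact div_pos_of_neg_of_neg (mul_neg_of_pos_of_neg ha hsin) (by nlinarith)
  · have hθπ : θ < π := lt_of_mul_lt_mul_left (by nlinarith [pi_pos]) ha.le
    have hsin : 0 < sin θ := sin_pos_of_pos_of_lt_pi (by positivity) hθπ
    exact div_pos (mul_pos ha hsin) (by nlinarith)

theorem integral_sin_mul_fucikWave_pos (ha : 0 < a) (hb : 0 < b) (hd : 0 < d)
    (h : n * fucikPeriod a b = 2 * π) :
    0 < ∫ t in 0..fucikPeriod a b, sin (n * t) * fucikWave a b d t := by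
  have hn := pos_of_mul_fucikPeriod ha hb h
  have hsum := div_add_div_eq_two h
  have hpa : 0 < π / a := by positivity
  have hpb : 0 < π / b := by positivity
  have hna : n < 2 * a := (div_lt_iff₀ ha).1 (by linarith [div_pos hn hb])
  have hnb : n < 2 * b := (div_lt_iff₀ hb).1 (by linarith [div_pos hn ha])
  have hfirst : ∫ t in 0..π / a, sin (n * t) * fucikWave a b d t =
      d / a * ∫ t in 0..π / a, sin (a * t) * sin (n * t) := by
    rw [← intervalIntegral.integral_const_mul]
    refine intervalIntegral.integral_congr fun t ht => ?_
    rw [uIcc_of_le hpa.le] at ht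
    simp only [fucikWave_of_le b d ht.2]
    ring
  -- The reflection `t ↦ fucikPeriod a b - t` turns the negative bump into `-sin (b t)`.
  have hsecond : ∫ t in π / a..fucikPeriod a b, sin (n * t) * fucikWave a b d t =
      d / b * ∫ t in 0..π / b, sin (b * t) * sin (n * t) := by
    rw [← intervalIntegral.integral_const_mul, ← sub_self (fucikPeriod a b),
      ← add_sub_cancel_left (π / a) (π / b), ← fucikPeriod,
      ← intervalIntegral.integral_comp_sub_left
        (fun t => d / b * (sin (b * t) * sin (n * t))) (fucikPeriod a b)]
    refine intervalIntegral.integral_congr fun t ht => ?_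
    rw [fucikPeriod, uIcc_of_le (le_add_of_nonneg_right hpb.le)] at ht
    simp only [fucikWave_of_ge ha.ne' hb.ne' d ht.1, mul_sub n, h, sin_two_pi_sub]
    rw [← neg_sub t, mul_neg b, sin_neg (b * _)]
    ring
  have hint (s t : ℝ) :
      IntervalIntegrable (fun t => sin (n * t) * fucikWave a b d t) volume s t :=
    (Continuous.mul (by fun_prop) (continuous_fucikWave ha.ne' hb.ne' d)).intervalIntegrable s t
  rw [← intervalIntegral.integral_add_adjacent_intervals (hint 0 (π / a)) (hint _ _), hfirst,
    hsecond]
  exact add_pos (mul_pos (by positivity) (integral_sin_bump_mul_sin_pos ha hn hna))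
    (mul_pos (by positivity) (integral_sin_bump_mul_sin_pos hb hn hnb))

theorem integral_sin_mul_fucikPeriodic_pos (ha : 0 < a) (hb : 0 < b) (hd : 0 < d)
    (h : n * fucikPeriod a b = 2 * π) {m : ℕ} (hm : m ≠ 0) :
    0 < ∫ x in 0..m * fucikPeriod a b, sin (n * x) * fucikPeriodic a b d x := by
  have hP := fucikPeriod_pos ha hb
  have hperiod : ∫ x in 0..fucikPeriod a b, sin (n * x) * fucikPeriodic a b d x =
      ∫ x in 0..fucikPeriod a b, sin (n * x) * fucikWave a b d x :=
    intervalIntegral.integral_congr_Ioo_of_le hP.le fun x hx => by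
      rw [fucikPeriodic_of_mem_Ico hP d (Ioo_subset_Ico_self hx)]
  have hrepeat := ((periodic_sin_mul h).mul
    (periodic_fucikPeriodic hP.ne' d)).intervalIntegral_add_zsmul_eq m 0 fun s t =>
      (intervalIntegrable_fucikPeriodic ha hb d s t).continuousOn_mul (by fun_prop)
  simp only [zero_add, zsmul_eq_mul, Int.cast_natCast, Pi.mul_apply] at hrepeat
  rw [hrepeat, hperiod]
  have hwave := integral_sin_mul_fucikWave_pos ha hb hd h
  positivity

theorem one_sub_inv_le_sub_one {x : ℝ} (hx : 0 < x) : 1 - x⁻¹ ≤ x - 1 := by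
  have hinv : x * x⁻¹ = 1 := mul_inv_cancel₀ hx.ne'
  nlinarith [sq_nonneg (x - 1), inv_pos.2 hx]

theorem abs_one_sub_div_le (ha : 0 < a) (hb : 0 < b) (hn : 0 < n) (h : n / a + n / b = 2) :
    |1 - n / a| ≤ max a b / n - 1 := by
  have hbound {c : ℝ} (hc : 0 < c) (hle : c ≤ max a b) : 1 - n / c ≤ max a b / n - 1 := calc
    1 - n / c ≤ c / n - 1 := inv_div c n ▸ one_sub_inv_le_sub_one (div_pos hc hn)
    _ ≤ max a b / n - 1 := by gcongr
  exact abs_le'.2 ⟨hbound ha (le_max_left a b), by linarith [hbound hb (le_max_right a b)]⟩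

theorem abs_div_sub_one_le (ha : 0 < a) (hb : 0 < b) (hn : 0 < n) (h : n / a + n / b = 2)
    (hmax : max (d / a) (d / b) = 1) : |d / a - 1| ≤ 2 * (max a b / n - 1) := by
  have hδ : 0 ≤ max a b / n - 1 := (abs_nonneg _).trans (abs_one_sub_div_le ha hb hn h)
  rcases max_choice (d / a) (d / b) with hchoice | hchoice
  · rw [← hchoice, hmax, sub_self, abs_zero]
    positivity
  · obtain rfl : d = b := (div_eq_one_iff_eq hb.ne').1 (hchoice ▸ hmax)
    have hle : d / a ≤ 1 := hmax ▸ le_max_left _ _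
    have hratio : a / d - 1 = 2 * (a / n - 1) := by
      have := congrArg (a / n * ·) h
      field_simp at this ⊢
      linear_combination this
    calc |d / a - 1| = 1 - d / a := by rw [abs_of_nonpos (sub_nonpos.2 hle), neg_sub]
      _ ≤ a / d - 1 := inv_div a d ▸ one_sub_inv_le_sub_one (div_pos ha hb)
      _ = 2 * (a / n - 1) := hratio
      _ ≤ 2 * (max a d / n - 1) := by gcongr; exact le_max_left a d

theorem abs_sin_mul_sub_sin_mul_le {c s : ℝ} (hc : 0 < c) (n : ℝ) (hs : |s| ≤ π / c) :
    |sin (c * s) - sin (n * s)| ≤ π * |1 - n / c| := calc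
  |sin (c * s) - sin (n * s)| ≤ |c * s - n * s| := by
    simpa [dist_eq] using lipschitzWith_sin.dist_le_mul (c * s) (n * s)
  _ = c * |s| * |1 - n / c| := by
    rw [← abs_of_pos hc, ← abs_mul, ← abs_mul, abs_of_pos hc]
    congr 1
    field_simp
  _ ≤ c * (π / c) * |1 - n / c| := by gcongr
  _ = π * |1 - n / c| := by rw [mul_div_cancel₀ _ hc.ne']

theorem abs_bump_sub_sin_le (ha : 0 < a) (hb : 0 < b) (hn : 0 < n) (h : n / a + n / b = 2)
    (hmax : max (d / a) (d / b) = 1) {s : ℝ} (hs : |s| ≤ π / a) :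
    |d / a * sin (a * s) - sin (n * s)| ≤ (2 + π) * (max a b / n - 1) := by
  have hamplitude : |(d / a - 1) * sin (a * s)| ≤ |d / a - 1| := by
    rw [abs_mul]
    exact mul_le_of_le_one_right (abs_nonneg _) (abs_sin_le_one _)
  calc |d / a * sin (a * s) - sin (n * s)|
      = |(d / a - 1) * sin (a * s) + (sin (a * s) - sin (n * s))| := by
        congr 1; ring
    _ ≤ |d / a - 1| + π * |1 - n / a| :=
        (abs_add_le _ _).trans (add_le_add hamplitude (abs_sin_mul_sub_sin_mul_le ha n hs))
    _ ≤ 2 * (max a b / n - 1) + π * (max a b / n - 1) := by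
        gcongr
        · exact abs_div_sub_one_le ha hb hn h hmax
        · exact abs_one_sub_div_le ha hb hn h
    _ = (2 + π) * (max a b / n - 1) := by ring

theorem abs_fucikWave_sub_sin_le (ha : 0 < a) (hb : 0 < b) (h : n * fucikPeriod a b = 2 * π)
    (hmax : max (d / a) (d / b) = 1) {t : ℝ} (ht : t ∈ Icc 0 (fucikPeriod a b)) :
    |fucikWave a b d t - sin (n * t)| ≤ (2 + π) * (max a b / n - 1) := by
  have hn := pos_of_mul_fucikPeriod ha hb h
  have hsum := div_add_div_eq_two h
  rcases le_total t (π / a) with hta | hta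
  · rw [fucikWave_of_le _ _ hta]
    exact abs_bump_sub_sin_le ha hb hn hsum hmax (by rwa [abs_of_nonneg ht.1])
  · have hs : |t - fucikPeriod a b| ≤ π / b := by
      rw [abs_of_nonpos (sub_nonpos.2 ht.2), fucikPeriod]
      linarith
    rw [fucikWave_of_ge ha.ne' hb.ne' _ hta, ← (periodic_sin_mul h).sub_eq t, max_comm a]
    exact abs_bump_sub_sin_le hb ha hn (by rwa [add_comm]) (by rwa [max_comm]) hs

theorem abs_fucikPeriodic_sub_sin_le (ha : 0 < a) (hb : 0 < b)
    (h : n * fucikPeriod a b = 2 * π) (hmax : max (d / a) (d / b) = 1) (x : ℝ) :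
    |fucikPeriodic a b d x - sin (n * x)| ≤ (2 + π) * (max a b / n - 1) := by
  have hP := fucikPeriod_pos ha hb
  obtain ⟨t, ht, hxt⟩ := ((periodic_fucikPeriodic hP.ne' d).sub
    (periodic_sin_mul h)).exists_mem_Ico₀ hP x
  simp only [Pi.sub_apply] at hxt
  rw [hxt, fucikPeriodic_of_mem_Ico hP d ht]
  exact abs_fucikWave_sub_sin_le ha hb h hmax (Ico_subset_Icc_self ht)

end FucikPeriodic

section FucikSystem

open Set Real

variable {α β : ℝ} {u : ℝ → ℝ} {m : ℕ}

theorem IsFucikSolution.eqOn_fucikPeriodic {a b d : ℝ} (h : IsFucikSolution (a ^ 2) (b ^ 2) u)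
    (ha : 0 < a) (hb : 0 < b) (hd : 0 ≤ d) (hslope : derivWithin u (Icc 0 π) 0 = d)
    (hm : m * fucikPeriod a b = π) : EqOn u (fucikPeriodic a b d) (Ico 0 π) := by
  intro x hx
  have hP := fucikPeriod_pos ha hb
  set P := fucikPeriod a b
  have hxP : 0 ≤ x / P := div_nonneg hx.1 hP.le
  set k := ⌊x / P⌋₊
  have hk : k < m := by
    rw [Nat.floor_lt hxP, div_lt_iff₀ hP, hm]
    exact hx.2
  have hkP : k * P + P ≤ π := by
    rw [← hm, ← add_one_mul]
    gcongr
    exact_mod_cast hk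
  have hxk : k * P + P * Int.fract (x / P) = x := by
    rw [mul_comm, ← mul_add, natCast_floor_eq_intCast_floor hxP, Int.floor_add_fract,
      mul_div_cancel₀ _ hP.ne']
  calc u x = u (k * P + P * Int.fract (x / P)) := by rw [hxk]
    _ = fucikPeriodic a b d x := h.eq_fucikWave ha hb hd hslope hkP
      ⟨mul_nonneg hP.le (Int.fract_nonneg _),
        mul_le_of_le_one_right hP.le (Int.fract_lt_one _).le⟩

theorem IsFucikSolution.isGreatest_abs {a b d : ℝ} (h : IsFucikSolution (a ^ 2) (b ^ 2) u)
    (ha : 0 < a) (hb : 0 < b) (hd : 0 ≤ d) (hslope : derivWithin u (Icc 0 π) 0 = d)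
    (hm : m * fucikPeriod a b = π) :
    IsGreatest ((fun x => |u x|) '' Icc 0 π) (max (d / a) (d / b)) := by
  have hpa : 0 < π / a := by positivity
  have hpb : 0 < π / b := by positivity
  have hP : fucikPeriod a b = π / a + π / b := rfl
  have hm1 : (1 : ℝ) ≤ m := by
    rw [Nat.one_le_cast, Nat.one_le_iff_ne_zero]
    rintro rfl
    exact pi_ne_zero (by rw [← hm, Nat.cast_zero, zero_mul])
  have hPπ : fucikPeriod a b ≤ π := hm ▸ le_mul_of_one_le_left (fucikPeriod_pos ha hb).le hm1
  have hwave {t : ℝ} (ht : t ∈ Icc 0 (fucikPeriod a b)) : u t = fucikWave a b d t := by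
    simpa using h.eq_fucikWave ha hb hd hslope (k := 0) (by simpa using hPπ) ht
  refine ⟨?_, ?_⟩
  · rcases max_choice (d / a) (d / b) with hmax | hmax <;> rw [hmax]
    · refine ⟨π / a / 2, ⟨by positivity, by linarith⟩, ?_⟩
      have hcrest : a * (π / a / 2) = π / 2 := by field_simp
      simp only
      rw [hwave ⟨by positivity, by linarith⟩, fucikWave_of_le _ _ (by linarith), hcrest,
        sin_pi_div_two, mul_one, abs_of_nonneg (by positivity)]
    · refine ⟨fucikPeriod a b - π / b / 2, ⟨by linarith, by linarith⟩, ?_⟩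
      have htrough : b * (fucikPeriod a b - π / b / 2 - fucikPeriod a b) = -(π / 2) := by
        field_simp
        ring
      simp only
      rw [hwave ⟨by linarith, by linarith⟩, fucikWave_of_ge ha.ne' hb.ne' _ (by linarith), htrough,
        sin_neg, sin_pi_div_two, mul_neg_one, abs_neg, abs_of_nonneg (by positivity)]
  · rintro _ ⟨x, hx, rfl⟩
    rcases hx.2.lt_or_eq with hxπ | rfl
    · simp only [h.eqOn_fucikPeriodic ha hb hd hslope hm ⟨hx.1, hxπ⟩]
      exact abs_fucikWave_le ha hb hd _
    · simp only [h.right_zero, abs_zero]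
      positivity

theorem isGreatest_abs_mul_sin {c : ℝ} (hc : 0 ≤ c) {n : ℕ} (hn : n ≠ 0) :
    IsGreatest ((fun x => |c * sin (n * x)|) '' Icc 0 π) c := by
  have hn1 : (1 : ℝ) ≤ n := Nat.one_le_cast.2 (Nat.one_le_iff_ne_zero.2 hn)
  refine ⟨⟨π / 2 / n, ⟨by positivity, ?_⟩, ?_⟩, ?_⟩
  · exact (div_le_self (by positivity) hn1).trans (half_le_self pi_pos.le)
  · simp only
    rw [mul_div_cancel₀ _ (by positivity), sin_pi_div_two, mul_one, abs_of_nonneg hc]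
  · rintro _ ⟨x, -, rfl⟩
    simp only [abs_mul, abs_of_nonneg hc]
    exact mul_le_of_le_one_right hc (abs_sin_le_one _)

theorem mul_fucikPeriod_of_mem_fucikCurve (h : (α, β) ∈ fucikCurve (2 * m)) :
    m * fucikPeriod √α √β = π := by
  obtain ⟨-, -, hcurve⟩ := h
  rw [if_pos (even_two_mul m)] at hcurve
  push_cast at hcurve
  rw [fucikPeriod]
  linear_combination hcurve

namespace IsNormalizedFucikEigenfunction

theorem continuousOn {n : ℕ} (h : IsNormalizedFucikEigenfunction n α β u) :
    ContinuousOn u (Icc 0 π) := by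
  rcases h with ⟨-, -, hsin⟩ | ⟨-, -, hsol, -⟩
  · exact continuous_sin.continuousOn.congr hsin
  · exact hsol.contDiffOn.continuousOn

theorem memLp {n : ℕ} (h : IsNormalizedFucikEigenfunction n α β u) :
    MemLp u 2 (volume.restrict (Ioo 0 π)) := by
  obtain ⟨C, hC⟩ := isCompact_Icc.exists_bound_of_continuousOn h.continuousOn
  exact MemLp.of_bound
    ((h.continuousOn.mono Ioo_subset_Icc_self).aestronglyMeasurable measurableSet_Ioo) C
    (ae_restrict_of_forall_mem measurableSet_Ioo fun x hx => hC x (Ioo_subset_Icc_self hx))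

theorem pos {n : ℕ} (h : IsNormalizedFucikEigenfunction n α β u) : 0 < n := by
  rcases h with ⟨rfl, -⟩ | ⟨hn, -⟩
  · exact one_pos
  · exact two_pos.trans_le hn

theorem eqOn_sin {n : ℕ} (h : IsNormalizedFucikEigenfunction n ((n : ℝ) ^ 2) ((n : ℝ) ^ 2) u) :
    EqOn u (fun x => sin (n * x)) (Icc 0 π) := by
  have hn := h.pos.ne'
  rcases h with ⟨rfl, -, hsin⟩ | ⟨-, -, hsol, hslope, hlub⟩
  · simpa only [Nat.cast_one, one_mul] using! hsin
  · set d := derivWithin u (Icc 0 π) 0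
    have hu : EqOn u (fun x => d / n * sin (n * x)) (Icc 0 π) :=
      fun x hx => hsol.eq_sin (Nat.cast_ne_zero.2 hn) hx
    rw [image_congr fun x hx => congrArg abs (hu hx)] at hlub
    have hone : d / n = 1 := (isGreatest_abs_mul_sin (by positivity) hn).isLUB.unique hlub
    simpa only [hone, one_mul] using hu

theorem mem_fucikCurve (h : IsNormalizedFucikEigenfunction (2 * m) α β u) :
    (α, β) ∈ fucikCurve (2 * m) := by
  rcases h with ⟨hodd, -⟩ | ⟨-, hcurve, -⟩
  · omega
  · exact hcurve

theorem sqrt_alpha_pos (h : IsNormalizedFucikEigenfunction (2 * m) α β u) : 0 < √α :=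
  sqrt_pos.2 h.mem_fucikCurve.1

theorem sqrt_beta_pos (h : IsNormalizedFucikEigenfunction (2 * m) α β u) : 0 < √β :=
  sqrt_pos.2 h.mem_fucikCurve.2.1

theorem mul_fucikPeriod (h : IsNormalizedFucikEigenfunction (2 * m) α β u) :
    m * fucikPeriod √α √β = π :=
  mul_fucikPeriod_of_mem_fucikCurve h.mem_fucikCurve

theorem two_mul_mul_fucikPeriod (h : IsNormalizedFucikEigenfunction (2 * m) α β u) :
    (2 * m : ℕ) * fucikPeriod √α √β = 2 * π := by
  rw [Nat.cast_mul, Nat.cast_two, mul_assoc, h.mul_fucikPeriod]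

theorem exists_eqOn_fucikPeriodic (h : IsNormalizedFucikEigenfunction (2 * m) α β u) :
    ∃ d, 0 < d ∧ max (d / √α) (d / √β) = 1 ∧ EqOn u (fucikPeriodic √α √β d) (Ico 0 π) := by
  have ha := h.sqrt_alpha_pos
  have hb := h.sqrt_beta_pos
  have hm := h.mul_fucikPeriod
  have hα : √α ^ 2 = α := sq_sqrt h.mem_fucikCurve.1.le
  have hβ : √β ^ 2 = β := sq_sqrt h.mem_fucikCurve.2.1.le
  rcases h with ⟨hodd, -⟩ | ⟨-, -, hsol, hslope, hlub⟩
  · omega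
  · rw [← hα, ← hβ] at hsol
    exact ⟨_, hslope, (hsol.isGreatest_abs ha hb hslope.le rfl hm).isLUB.unique hlub,
      hsol.eqOn_fucikPeriodic ha hb hslope.le rfl hm⟩

theorem integral_sin_two_mul_mul_pos (h : IsNormalizedFucikEigenfunction (2 * m) α β u) :
    0 < ∫ x in 0..π, sin ((2 * m : ℕ) * x) * u x := by
  have hm : m ≠ 0 := right_ne_zero_of_mul h.pos.ne'
  obtain ⟨d, hd, -, hu⟩ := h.exists_eqOn_fucikPeriodic
  calc 0 < ∫ x in 0..m * fucikPeriod √α √β, sin ((2 * m : ℕ) * x) * fucikPeriodic √α √β d x :=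
        integral_sin_mul_fucikPeriodic_pos h.sqrt_alpha_pos h.sqrt_beta_pos hd
          h.two_mul_mul_fucikPeriod hm
    _ = ∫ x in 0..π, sin ((2 * m : ℕ) * x) * u x := by
      rw [h.mul_fucikPeriod]
      refine intervalIntegral.integral_congr_Ioo_of_le pi_pos.le fun x hx => ?_
      rw [hu (Ioo_subset_Ico_self hx)]

theorem integral_sin_two_mul_mul_eq_zero (h : IsNormalizedFucikEigenfunction (2 * m) α β u)
    {i : ℕ} (hi : ¬ m ∣ i) : ∫ x in 0..π, sin ((2 * i : ℕ) * x) * u x = 0 := by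
  obtain ⟨d, -, -, hu⟩ := h.exists_eqOn_fucikPeriodic
  calc ∫ x in 0..π, sin ((2 * i : ℕ) * x) * u x
      = ∫ x in 0..π, sin ((2 * i : ℕ) * x) * fucikPeriodic √α √β d x := by
        refine intervalIntegral.integral_congr_Ioo_of_le pi_pos.le fun x hx => ?_
        rw [hu (Ioo_subset_Ico_self hx)]
    _ = 0 := integral_sin_mul_periodic_eq_zero h.mul_fucikPeriod
        (periodic_fucikPeriodic (fucikPeriod_pos h.sqrt_alpha_pos h.sqrt_beta_pos).ne' d)
        (intervalIntegrable_fucikPeriodic h.sqrt_alpha_pos h.sqrt_beta_pos d _ _) hi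

theorem abs_sub_sin_two_mul_le (h : IsNormalizedFucikEigenfunction (2 * m) α β u) {x : ℝ}
    (hx : x ∈ Ico 0 π) :
    |u x - sin ((2 * m : ℕ) * x)| ≤ (2 + π) * (max √α √β / (2 * m : ℕ) - 1) := by
  obtain ⟨d, -, hmax, hu⟩ := h.exists_eqOn_fucikPeriodic
  rw [hu hx]
  exact abs_fucikPeriodic_sub_sin_le h.sqrt_alpha_pos h.sqrt_beta_pos h.two_mul_mul_fucikPeriod
    hmax x

variable {n : ℕ}

theorem abs_sub_sin_le (h : IsNormalizedFucikEigenfunction n α β u)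
    (hodd : Odd n → α = (n : ℝ) ^ 2 ∧ β = (n : ℝ) ^ 2) {x : ℝ} (hx : x ∈ Ico 0 π) :
    |u x - sin (n * x)| ≤ (2 + π) * (max √α √β / n - 1) := by
  rcases n.even_or_odd with hn | hn
  · obtain ⟨m, rfl⟩ := hn.two_dvd
    exact h.abs_sub_sin_two_mul_le hx
  · have hn0 : (n : ℝ) ≠ 0 := Nat.cast_ne_zero.2 h.pos.ne'
    obtain ⟨rfl, rfl⟩ := hodd hn
    rw [h.eqOn_sin (Ico_subset_Icc_self hx), sqrt_sq n.cast_nonneg, max_self, div_self hn0]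
    simp

theorem integral_sub_sin_sq_le (h : IsNormalizedFucikEigenfunction n α β u)
    (hodd : Odd n → α = (n : ℝ) ^ 2 ∧ β = (n : ℝ) ^ 2) :
    ∫ x in 0..π, (u x - sin (n * x)) ^ 2 ≤ (2 + π) ^ 2 * π * (max √α √β / n - 1) ^ 2 := by
  set δ := max √α √β / n - 1
  have hbound (x : ℝ) (hx : x ∈ Ico 0 π) : ‖(u x - sin (n * x)) ^ 2‖ ≤ ((2 + π) * δ) ^ 2 := by
    rw [norm_pow, norm_eq_abs]
    exact pow_le_pow_left₀ (abs_nonneg _) (h.abs_sub_sin_le hodd hx) 2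
  have hnorm := norm_setIntegral_le_of_norm_le_const (μ := volume) measure_Ico_lt_top hbound
  rw [volume_real_Ico_of_le pi_pos.le, sub_zero] at hnorm
  calc ∫ x in 0..π, (u x - sin (n * x)) ^ 2
      ≤ ((2 + π) * δ) ^ 2 * π := by
        rw [intervalIntegral.integral_of_le pi_pos.le, ← integral_Ico_eq_integral_Ioc]
        exact (le_norm_self _).trans hnorm
    _ = (2 + π) ^ 2 * π * δ ^ 2 := by ring

theorem integral_sin_mul_of_odd (h : IsNormalizedFucikEigenfunction n α β u)
    (hodd : Odd n → α = (n : ℝ) ^ 2 ∧ β = (n : ℝ) ^ 2) (hn : Odd n) (k : ℕ) :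
    ∫ x in 0..π, sin (k * x) * u x = if k = n then π / 2 else 0 := by
  obtain ⟨rfl, rfl⟩ := hodd hn
  rw [← integral_sin_nat_mul_sin_nat hn.pos.ne']
  refine intervalIntegral.integral_congr fun x hx => ?_
  rw [uIcc_of_le pi_pos.le] at hx
  simp only [h.eqOn_sin hx]

theorem integral_sin_mul_pos (h : IsNormalizedFucikEigenfunction n α β u)
    (hodd : Odd n → α = (n : ℝ) ^ 2 ∧ β = (n : ℝ) ^ 2) :
    0 < ∫ x in 0..π, sin (n * x) * u x := by
  rcases n.even_or_odd with hn | hn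
  · obtain ⟨m, rfl⟩ := hn.two_dvd
    exact h.integral_sin_two_mul_mul_pos
  · rw [h.integral_sin_mul_of_odd hodd hn, if_pos rfl]
    positivity

theorem integral_sin_mul_eq_zero (h : IsNormalizedFucikEigenfunction n α β u)
    (hodd : Odd n → α = (n : ℝ) ^ 2 ∧ β = (n : ℝ) ^ 2) {k : ℕ} (hkn : k ≠ n)
    (heven : Even n → Even k ∧ ¬ n ∣ k) : ∫ x in 0..π, sin (k * x) * u x = 0 := by
  rcases n.even_or_odd with hn | hn
  · obtain ⟨hk, hdvd⟩ := heven hn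
    obtain ⟨m, rfl⟩ := hn.two_dvd
    obtain ⟨i, rfl⟩ := hk.two_dvd
    exact h.integral_sin_two_mul_mul_eq_zero (mt (mul_dvd_mul_left 2) hdvd)
  · rw [h.integral_sin_mul_of_odd hodd hn, if_neg hkn]

end IsNormalizedFucikEigenfunction

end FucikSystem

theorem theorem2 (𝕜 : Type*) [RCLike 𝕜] (α β : ℕ → ℝ) (F : ℕ → ℝ → ℝ)
    (hF : IsFucikSystem α β F)
    (hodd : ∀ n : ℕ, Odd n → α n = (n : ℝ) ^ 2 ∧ β n = (n : ℝ) ^ 2)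
    (hsum : Summable fun n : ℕ =>
      (max √(α (n + 2)) √(β (n + 2)) / ((n + 2 : ℕ) : ℝ) - 1) ^ 2) :
    IsRieszBasisL2 𝕜 F := by
  have hf (n : ℕ) := hF.eigenfunction (n + 1) n.succ_pos
  have hclose : Summable fun n : ℕ =>
      ∫ x in 0..Real.pi, (F (n + 1) x - Real.sin ((n + 1 : ℕ) * x)) ^ 2 :=
    (summable_nat_add_iff 1).1 <| (hsum.mul_left ((2 + Real.pi) ^ 2 * Real.pi)).of_nonneg_of_le
      (fun _ => intervalIntegral.integral_nonneg Real.pi_pos.le fun _ _ => sq_nonneg _)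
      (fun n => (hf (n + 1)).integral_sub_sin_sq_le (hodd _))
  -- The rank puts the even indices first, in increasing order, and the odd ones after them.
  refine isRieszBasisL2_of_triangular 𝕜 (fun n => (hf n).memLp) hclose
    (rank := fun n => toLex ((n + 1) % 2, n))
    (fun n => ((hf n).integral_sin_mul_pos (hodd _)).ne') fun n m hmn hrank => ?_
  rw [Prod.Lex.toLex_lt_toLex] at hrank
  refine (hf m).integral_sin_mul_eq_zero (hodd _) (by omega) fun hm => ?_
  have hlt : Even (n + 1) ∧ n + 1 < m + 1 := by
    rw [Nat.even_iff] at hm ⊢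
    omega
  exact ⟨hlt.1, Nat.not_dvd_of_pos_of_lt n.succ_pos hlt.2⟩
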